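/- For $x\in\mathbb{Q}_p$ and $n\ge 0$ write $(x)_n=x(x+1)\cdots(x+n-1)$, with $(x)_0=1$. For an odd prime $p$ let $\Gamma_p:\mathbb{Z}_p\to\mathbb{Z}_p$ be Morita's $p$-adic Gamma function, that is, $\Gamma_p(0)=1$, $\Gamma_p(n)=(-1)^n\prod_{1\le k<n,\ p\nmid k}k$ for positive integers $n$, and $\Gamma_p(x)=\lim_{n\to x}\Gamma_p(n)$ for $x\in\mathbb{Z}_p$, where $n$ runs through natural numbers tending to $x$ $p$-adically. For $x,y\in\mathbb{Q}_p$, $x\equiv y\pmod{p^3}$ means $x-y\in p^3\mathbb{Z}_p$. **Proposition.** Let $p$ be an odd prime. 1. If $p\equiv1\pmod 3$, then $$\frac{(2/3)_{(p-1)/3}^2}{(1)_{(p-1)/3}^2}\Bigl\{1+p^2\sum_{i=1}^{(p-1)/3}\frac1{(3i-1)^2}\Bigr\}\equiv\Gamma_p(1/3)^6\pmod{p^3}.$$ 2. If $p\equiv2\pmod 3$, then $$\frac{(2/3)_{(2p-1)/3}^2}{(1)_{(2p-1)/3}^2}\Bigl\{1-4p^2\sum_{i=1}^{(2p-1)/3}\frac1{(3i-1)^2}\Bigr\}\equiv-\frac{p^2}{3}\Gamma_p(1/3)^6\pmod{p^3}.$$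 3. Consequently, if $p\equiv t\pmod 3$ with $t\in\{1,2\}$, then the congruence $$\sum_{k=0}^{(tp-1)/3}\frac{(1/3)_k^3}{k!^3}\equiv\frac{(2/3)_{(tp-1)/3}^2}{(1)_{(tp-1)/3}^2}\Bigl\{1+(-1)^{t-1}(tp)^2\sum_{i=1}^{(tp-1)/3}\frac1{(3i-1)^2}\Bigr\}\pmod{p^3}$$ holds if and only if the Long–Ramakrishna congruence $$\sum_{k=0}^{p-1}\frac{(1/3)_k^3}{k!^3}\equiv\begin{cases}\Gamma_p(1/3)^6\pmod{p^3},&t=1,\\[4pt]-\dfrac{p^2}{3}\Gamma_p(1/3)^6\pmod{p^3},&t=2,\end{cases}$$ holds. -/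

import Mathlib

/-- Morita's function at natural numbers: `Γ_p(0) = 1` and
`Γ_p(n) = (-1)^n ∏_{1 ≤ k < n, p ∤ k} k` for `n ≥ 1` (the formula also gives `1` at `n = 0`). -/
noncomputable def moritaNat (p : ℕ) [Fact p.Prime] (n : ℕ) : ℤ_[p] :=
  (-1) ^ n * ∏ k ∈ (Finset.Ico 1 n).filter (fun k => ¬ p ∣ k), (k : ℤ_[p])

/-- Morita's `p`-adic Gamma function on `ℤ_p`, for an odd prime `p`: the limit of `Γ_p(n)` as the
natural number `n` tends to `x` in the `p`-adic metric. -/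
noncomputable def padicGamma (p : ℕ) [Fact p.Prime] (x : ℤ_[p]) : ℤ_[p] :=
  Filter.limUnder (Filter.comap (Nat.cast : ℕ → ℤ_[p]) (nhds x)) (moritaNat p)

/-- The element `1/3` of `ℤ_p`, for `p ≠ 3`. -/
noncomputable def oneThird (p : ℕ) [Fact p.Prime] : ℤ_[p] := Ring.inverse 3

theorem three_mul_oneThird (p : ℕ) [Fact p.Prime] (hp : p ≠ 3) : 3 * oneThird p = 1 := by
  have hpp : p.Prime := Fact.out
  refine Ring.mul_inverse_cancel _ ?_
  have h : IsUnit ((3 : ℕ) : ℤ_[p]) := by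
    rw [PadicInt.isUnit_iff, PadicInt.norm_natCast_eq_one_iff]
    exact (Nat.coprime_primes hpp Nat.prime_three).2 hp
  exact_mod_cast h

/-- `x ≡ y (mod m)` for `p`-adic numbers: the difference lies in `m ℤ_p`. -/
def PadicCongr (p : ℕ) [Fact p.Prime] (m : ℕ) (x y : ℚ_[p]) : Prop :=
  ∃ z : ℤ_[p], x - y = (m : ℚ_[p]) * (z : ℚ_[p])

/-- The shifted factorial `(x)_n = x (x + 1) ⋯ (x + n - 1)`. -/
noncomputable def shiftedFactorial (p : ℕ) [Fact p.Prime] (x : ℚ_[p]) (n : ℕ) : ℚ_[p] :=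
  (ascPochhammer ℚ_[p] n).eval x

/-- The truncated series `∑_{k=0}^{N} (1/3)_k^3 / k!^3`. -/
noncomputable def truncatedSum (p : ℕ) [Fact p.Prime] (N : ℕ) : ℚ_[p] :=
  ∑ k ∈ Finset.range (N + 1), shiftedFactorial p (1 / 3) k ^ 3 / (k.factorial : ℚ_[p]) ^ 3

/-- The expression
`(2/3)_N^2 / (1)_N^2 * {1 + (-1)^(t-1) (t p)^2 ∑_{i=1}^{N} 1 / (3 i - 1)^2}`, `N = (t p - 1) / 3`,
used for `t ∈ {1, 2}` and `p ≡ t (mod 3)`, in which case the division in `N` is exact. -/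
noncomputable def closedForm (p : ℕ) [Fact p.Prime] (t : ℕ) : ℚ_[p] :=
  shiftedFactorial p (2 / 3) ((t * p - 1) / 3) ^ 2 / shiftedFactorial p 1 ((t * p - 1) / 3) ^ 2 *
    (1 + (-1) ^ (t - 1) * ((t : ℚ_[p]) * (p : ℚ_[p])) ^ 2 *
      ∑ i ∈ Finset.Icc 1 ((t * p - 1) / 3), 1 / (3 * (i : ℚ_[p]) - 1) ^ 2)

/-! The limit that defines `padicGamma` exists. -/

theorem prod_isUnit_zmod (p : ℕ) [Fact p.Prime] (hp : p ≠ 2) (k : ℕ) (hk : k ≠ 0)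
    [NeZero (p ^ k)] :
    ∏ a ∈ (Finset.univ : Finset (ZMod (p ^ k))).filter IsUnit, a = -1 := by
  have hpp : p.Prime := Fact.out
  have h3 : 2 < p := lt_of_le_of_ne hpp.two_le (Ne.symm hp)
  have hN : 2 < p ^ k := lt_of_lt_of_le h3 (Nat.le_self_pow hk p)
  have : Fact (2 < p ^ k) := ⟨hN⟩
  have hne : (1 : ZMod (p ^ k)) ≠ -1 := (ZMod.neg_one_ne_one).symm
  set s := (Finset.univ : Finset (ZMod (p ^ k))).filter IsUnit with hs
  have hsub : ({1, -1} : Finset (ZMod (p ^ k))) ⊆ s := by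
    intro a ha
    simp only [Finset.mem_insert, Finset.mem_singleton] at ha
    rcases ha with rfl | rfl
    · simp [hs]
    · simp [hs]
  rw [← Finset.prod_sdiff hsub, Finset.prod_pair hne]
  have h1 : ∏ a ∈ s \ {1, -1}, a = 1 := by
    have hu : ∀ a ∈ s \ {1, -1}, IsUnit a := by
      intro a ha
      have := (Finset.mem_sdiff.1 ha).1
      simpa [hs] using this
    have hsq : ∀ a : ZMod (p ^ k), a * a = 1 → a = 1 ∨ a = -1 := by
      intro a ha
      obtain ⟨z, rfl⟩ := ZMod.intCast_surjective a
      have hd : ((p : ℤ) ^ k) ∣ (z - 1) * (z + 1) := by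
        have h0 : (((z - 1) * (z + 1) : ℤ) : ZMod (p ^ k)) = 0 := by
          push_cast; linear_combination ha
        have := (ZMod.intCast_zmod_eq_zero_iff_dvd _ _).1 h0
        exact_mod_cast this
      have hpz : Prime (p : ℤ) := Nat.prime_iff_prime_int.1 hpp
      by_cases hd1 : (p : ℤ) ∣ z - 1
      · have hd2 : ¬ (p : ℤ) ∣ z + 1 := by
          intro h
          have h2 : (p : ℤ) ∣ 2 := by
            have := dvd_sub h hd1
            have e : z + 1 - (z - 1) = 2 := by ring
            rwa [e] at this
          have := Int.le_of_dvd (by norm_num) h2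
          omega
        left
        have h4 := hpz.pow_dvd_of_dvd_mul_right k hd2 hd
        have : ((z - 1 : ℤ) : ZMod (p ^ k)) = 0 :=
          (ZMod.intCast_zmod_eq_zero_iff_dvd _ _).2 (by exact_mod_cast h4)
        push_cast at this
        exact sub_eq_zero.1 this
      · right
        have h4 := hpz.pow_dvd_of_dvd_mul_left k hd1 hd
        have : ((z + 1 : ℤ) : ZMod (p ^ k)) = 0 :=
          (ZMod.intCast_zmod_eq_zero_iff_dvd _ _).2 (by exact_mod_cast h4)
        push_cast at this
        exact eq_neg_of_add_eq_zero_left this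
    refine Finset.prod_involution (fun a _ => a⁻¹) ?_ ?_ ?_ ?_
    · intro a ha
      exact ZMod.mul_inv_of_unit a (hu a ha)
    · intro a ha _ h
      have h2 := ZMod.mul_inv_of_unit a (hu a ha)
      rw [h] at h2
      have := hsq a h2
      simp only [Finset.mem_sdiff, Finset.mem_insert, Finset.mem_singleton] at ha
      exact ha.2 this
    · intro a ha
      have h2 := ZMod.mul_inv_of_unit a (hu a ha)
      have h3 : IsUnit a⁻¹ := IsUnit.of_mul_eq_one a (by rw [mul_comm]; exact h2)
      simp only [Finset.mem_sdiff, Finset.mem_insert, Finset.mem_singleton] at ha ⊢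
      refine ⟨by simpa [hs] using h3, ?_⟩
      rintro (h | h)
      · rw [h, mul_one] at h2; exact ha.2 (Or.inl h2)
      · rw [h] at h2; exact ha.2 (Or.inr (by linear_combination -h2))
    · intro a ha
      have h2 := ZMod.mul_inv_of_unit a (hu a ha)
      have h3 : IsUnit a⁻¹ := IsUnit.of_mul_eq_one a (by rw [mul_comm]; exact h2)
      have h4 := ZMod.mul_inv_of_unit a⁻¹ h3
      calc a⁻¹⁻¹ = (a * a⁻¹) * a⁻¹⁻¹ := by rw [h2, one_mul]
        _ = a * (a⁻¹ * a⁻¹⁻¹) := by ring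
        _ = a := by rw [h4, mul_one]
  rw [h1]; ring

theorem moritaNat_eq (p : ℕ) [Fact p.Prime] (n : ℕ) :
    moritaNat p n = (-1) ^ n * ∏ j ∈ Finset.range n, if p ∣ j then 1 else (j : ℤ_[p]) := by
  unfold moritaNat
  congr 1
  rw [Finset.prod_filter]
  cases n with
  | zero => simp
  | succ n =>
    rw [Finset.range_eq_Ico, Finset.prod_eq_prod_Ico_succ_bot (Nat.succ_pos n)]
    simp [ite_not]

theorem moritaNat_add_pow (p : ℕ) [Fact p.Prime] (hp : p ≠ 2) (k n : ℕ) :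
    PadicInt.toZModPow k (moritaNat p (n + p ^ k)) = PadicInt.toZModPow k (moritaNat p n) := by
  classical
  have hpp : p.Prime := Fact.out
  rcases Nat.eq_zero_or_pos k with rfl | hk
  · have : Subsingleton (ZMod (p ^ 0)) := by rw [pow_zero]; infer_instance
    exact Subsingleton.elim _ _
  have : NeZero (p ^ k) := ⟨pow_ne_zero _ hpp.ne_zero⟩
  have hodd : Odd (p ^ k) := (hpp.odd_of_ne_two hp).pow
  set h : ZMod (p ^ k) → ZMod (p ^ k) := fun a => if IsUnit a then a else 1 with hh
  have hg : ∀ j : ℕ, PadicInt.toZModPow (p := p) k (if p ∣ j then 1 else (j : ℤ_[p]))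
      = h (j : ZMod (p ^ k)) := by
    intro j
    have hiff : IsUnit (j : ZMod (p ^ k)) ↔ ¬ p ∣ j := by
      rw [ZMod.isUnit_iff_coprime, Nat.coprime_pow_right_iff hk, Nat.coprime_comm,
        hpp.coprime_iff_not_dvd]
    by_cases hj : p ∣ j
    · simp [hh, hiff, hj]
    · simp [hh, hiff, hj]
  have hwin : ∏ i ∈ Finset.range (p ^ k), h ((n + i : ℕ) : ZMod (p ^ k)) = -1 := by
    have e1 : ∏ i ∈ Finset.range (p ^ k), h ((n + i : ℕ) : ZMod (p ^ k))
        = ∏ a : ZMod (p ^ k), h ((n : ZMod (p ^ k)) + a) := by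
      refine Finset.prod_bij' (fun i _ => (i : ZMod (p ^ k))) (fun a _ => a.val) ?_ ?_ ?_ ?_ ?_
      · intro i _; exact Finset.mem_univ _
      · intro a _; exact Finset.mem_range.2 (ZMod.val_lt a)
      · intro i hi; exact ZMod.val_cast_of_lt (Finset.mem_range.1 hi)
      · intro a _; exact ZMod.natCast_zmod_val a
      · intro i _; push_cast; rfl
    have e2 := Equiv.prod_comp (Equiv.addLeft (n : ZMod (p ^ k))) h
    simp only [Equiv.coe_addLeft] at e2
    rw [e1, e2, ← Finset.prod_filter,
      prod_isUnit_zmod p hp k hk.ne']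
  rw [moritaNat_eq, moritaNat_eq, Finset.prod_range_add, pow_add, hodd.neg_one_pow]
  simp only [map_mul, map_prod, hg, map_pow, map_neg, map_one]
  rw [hwin]
  ring

/-- For odd `p`, the limit defining `padicGamma p x` exists. -/
theorem tendsto_moritaNat (p : ℕ) [Fact p.Prime] (hp : p ≠ 2) (x : ℤ_[p]) :
    Filter.Tendsto (moritaNat p) (Filter.comap (Nat.cast : ℕ → ℤ_[p]) (nhds x))
      (nhds (padicGamma p x)) := by
  have hpp : p.Prime := Fact.out
  have : (Filter.comap (Nat.cast : ℕ → ℤ_[p]) (nhds x)).NeBot := by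
    rw [Filter.comap_neBot_iff_frequently]
    exact (mem_closure_iff_frequently.1 (PadicInt.denseRange_natCast (p := p) x)).mono
      fun y hy => hy
  have hper : ∀ k n c : ℕ, PadicInt.toZModPow k (moritaNat p (n + c * p ^ k))
      = PadicInt.toZModPow k (moritaNat p n) := by
    intro k n c
    induction c with
    | zero => simp
    | succ c ih => rw [add_mul, one_mul, ← add_assoc, moritaNat_add_pow p hp, ih]
  have hcong : ∀ k a b : ℕ, a ≡ b [MOD p ^ k] → PadicInt.toZModPow k (moritaNat p a)
      = PadicInt.toZModPow k (moritaNat p b) := by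
    intro k a b hab
    have ha := hper k (a % p ^ k) (a / p ^ k)
    have hb := hper k (b % p ^ k) (b / p ^ k)
    rw [mul_comm, Nat.mod_add_div] at ha hb
    rw [ha, hb, hab]
  have hdist : ∀ k a b : ℕ, ‖(a : ℤ_[p]) - b‖ ≤ (p : ℝ) ^ (-(k : ℤ)) →
      ‖moritaNat p a - moritaNat p b‖ ≤ (p : ℝ) ^ (-(k : ℤ)) := by
    intro k a b hab
    rw [PadicInt.norm_le_pow_iff_mem_span_pow, ← PadicInt.ker_toZModPow, RingHom.mem_ker,
      map_sub, sub_eq_zero] at hab ⊢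
    refine hcong k a b ?_
    rw [map_natCast, map_natCast] at hab
    exact (ZMod.natCast_eq_natCast_iff _ _ _).1 hab
  have hcauchy : Cauchy (Filter.map (moritaNat p)
      (Filter.comap (Nat.cast : ℕ → ℤ_[p]) (nhds x))) := by
    rw [Metric.cauchy_iff]
    refine ⟨inferInstance, fun ε hε => ?_⟩
    obtain ⟨k, hk⟩ := PadicInt.exists_pow_neg_lt p hε
    have hpos : (0 : ℝ) < (p : ℝ) ^ (-(k : ℤ)) :=
      zpow_pos (by exact_mod_cast hpp.pos) _
    refine ⟨moritaNat p '' (Nat.cast ⁻¹' Metric.ball x ((p : ℝ) ^ (-(k : ℤ)))),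
      Filter.image_mem_map (Filter.preimage_mem_comap (Metric.ball_mem_nhds x hpos)), ?_⟩
    rintro _ ⟨a, ha, rfl⟩ _ ⟨b, hb, rfl⟩
    rw [dist_eq_norm]
    refine lt_of_le_of_lt (hdist k a b ?_) hk
    rw [Set.mem_preimage, Metric.mem_ball, dist_eq_norm] at ha hb
    have e : (a : ℤ_[p]) - b = (a - x) + -(b - x) := by ring
    rw [e]
    refine le_trans (PadicInt.nonarchimedean _ _) (max_le ha.le ?_)
    rw [norm_neg]
    exact hb.le
  obtain ⟨l, hl⟩ := CompleteSpace.complete hcauchy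
  exact tendsto_nhds_limUnder ⟨l, hl⟩

/-!
Everything is read off from the square `g = Γ_p ^ 2` modulo `p ^ k`, a function on `ℤ / p ^ k` with
`g (x + 1) = u(x) ^ 2 g (x)`, where `u(x)` is `x` for units and `1` otherwise, and with
`g (x) g (1 - x) = 1` (`gammaSq_add_one`, `gammaSq_mul_gammaSq_one_sub`). Iterating the first
relation writes shifted factorials as quotients of values of `g`, and reflection turns the quotient
of `(2/3)_N ^ 2` by `N! ^ 2` into `g (-N) g (2/3 + N) g (1/3)` (`sq_prod_unitPart_two_mul_add`).

For `p = 3 N + 1` the arguments are `-N = 1/3 - p/3` and `2/3 + N = 1/3 + p/3`. The symmetric product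
`g (a + p x) g (a - p x)` equals `g (a) ^ 2 (1 + 2 p x ^ 2 S)` modulo `p ^ 3`, with `S` the sum of
the inverses of the units among `a, …, a + p - 1` (`apply_add_mul_apply_sub`). It is proved for
natural `x` by induction, and every residue class contains a natural number, in particular that of
`1/3`. For `a = 1/3` a reflection of the summation index expresses `p S` by
`p ^ 2 ∑ 1 / (3 i - 1) ^ 2` (`two_mul_sum_inverse_three_mul_add_one`), and the factor in the
statement cancels the correction.

For `p ≡ 2 (mod 3)` exactly one factor of `(2/3)_N` and one summand `1 / (3 i - 1) ^ 2` involve `p`.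
A factor `p ^ 2` splits off, and what is left is needed only modulo `p`, where all three values of
`g` are `g (1/3)`.

The equivalence of the two truncated congruences follows, because the terms with `N < k < p` are
divisible by `p ^ 3` (`truncatedSum_congr`).
-/

/-! ### The functional equation over a commutative ring -/

/-- The element `x` if it is a unit, and `1` otherwise: up to sign, the factor by which
`Γ_p` changes from `x` to `x + 1`. -/
noncomputable def unitPart {R : Type*} [CommRing R] (x : R) : R :=
  open Classical in if IsUnit x then x else 1

section CommRing

variable {R : Type*} [CommRing R]

theorem unitPart_of_isUnit {x : R} (hx : IsUnit x) : unitPart x = x := by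
  simp [unitPart, hx]

theorem unitPart_of_not_isUnit {x : R} (hx : ¬ IsUnit x) : unitPart x = 1 := by
  simp [unitPart, hx]

theorem isUnit_unitPart (x : R) : IsUnit (unitPart x) := by
  by_cases hx : IsUnit x
  · rwa [unitPart_of_isUnit hx]
  · rw [unitPart_of_not_isUnit hx]; exact isUnit_one

theorem unitPart_neg_sq (x : R) : unitPart (-x) ^ 2 = unitPart x ^ 2 := by
  by_cases hx : IsUnit x
  · rw [unitPart_of_isUnit hx, unitPart_of_isUnit hx.neg, neg_sq]
  · rw [unitPart_of_not_isUnit hx, unitPart_of_not_isUnit (by rwa [IsUnit.neg_iff])]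

theorem map_ringInverse_of_isUnit {S : Type*} [CommRing S] (f : R →+* S) {x : R}
    (hx : IsUnit x) : f (Ring.inverse x) = Ring.inverse (f x) := by
  refine (hx.map f).mul_left_cancel ?_
  rw [Ring.mul_inverse_cancel _ (hx.map f), ← map_mul, Ring.mul_inverse_cancel _ hx, map_one]

theorem isUnit_add_nilpotent_mul_iff {ε : R} (hε : ε ^ 3 = 0) (x y : R) :
    IsUnit (x + ε * y) ↔ IsUnit x := by
  have hn : ∀ z, IsNilpotent (ε * z) := fun z => ⟨3, by rw [mul_pow, hε, zero_mul]⟩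
  constructor
  · intro h
    have := (hn (-y)).isUnit_add_left_of_commute h (Commute.all _ _)
    rwa [show x + ε * y + ε * -y = x by ring] at this
  · intro h
    exact (hn y).isUnit_add_left_of_commute h (Commute.all _ _)

theorem unitPart_add_nilpotent_mul {ε : R} (hε : ε ^ 3 = 0) (x y : R) :
    unitPart (x + ε * y) = unitPart x * (1 + ε * y * Ring.inverse x) := by
  by_cases hx : IsUnit x
  · rw [unitPart_of_isUnit hx,
      unitPart_of_isUnit ((isUnit_add_nilpotent_mul_iff hε x y).2 hx)]
    linear_combination (-ε * y) * Ring.mul_inverse_cancel x hx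
  · rw [unitPart_of_not_isUnit hx, Ring.inverse_non_unit x hx,
      unitPart_of_not_isUnit (by rwa [isUnit_add_nilpotent_mul_iff hε])]
    ring

theorem sq_mul_inverse_add_nilpotent_mul {ε : R} (hε : ε ^ 3 = 0) (x y : R) :
    ε ^ 2 * Ring.inverse (x + ε * y) = ε ^ 2 * Ring.inverse x := by
  by_cases hx : IsUnit x
  · have hxy := (isUnit_add_nilpotent_mul_iff hε x y).2 hx
    refine hx.mul_left_cancel (hxy.mul_left_cancel ?_)
    linear_combination (ε ^ 2 * x) * Ring.mul_inverse_cancel _ hxy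
      - (ε ^ 2 * (x + ε * y)) * Ring.mul_inverse_cancel _ hx - y * hε
  · rw [Ring.inverse_non_unit x hx,
      Ring.inverse_non_unit _ (by rwa [isUnit_add_nilpotent_mul_iff hε])]

/-- If `a + b = c ε` then `1 / a + 1 / b = c ε / (a b)`, and `b` may be replaced by `-a` in the
denominator once there is a factor `ε ^ 2`. For a non-unit `a` both sides vanish, because
`Ring.inverse` does. -/
theorem mul_inverse_add_inverse {ε : R} (hε : ε ^ 3 = 0) {a b c : R} (hab : a + b = ε * c) :
    ε * (Ring.inverse a + Ring.inverse b) = -(c * ε ^ 2 * Ring.inverse a ^ 2) := by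
  obtain rfl : b = -a + ε * c := by linear_combination hab
  by_cases ha : IsUnit a
  · have hb : IsUnit (-a + ε * c) := (isUnit_add_nilpotent_mul_iff hε _ _).2 ha.neg
    have h1 := Ring.mul_inverse_cancel a ha
    have h2 := Ring.mul_inverse_cancel _ hb
    generalize Ring.inverse (-a + ε * c) = v at *
    generalize Ring.inverse a = w at *
    refine ha.mul_left_cancel (ha.mul_left_cancel (hb.mul_left_cancel ?_))
    linear_combination (ε * a * (-a + ε * c) + c * ε ^ 2 * (-a + ε * c) * (a * w + 1)) * h1
      + ε * a ^ 2 * h2 + c ^ 2 * hε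
  · rw [Ring.inverse_non_unit a ha, Ring.inverse_non_unit (-a + ε * c)
      (by rwa [isUnit_add_nilpotent_mul_iff hε, IsUnit.neg_iff])]
    ring

/-- Newton's identity `2 e₂ = p₁² - p₂` gives the product to second order. -/
theorem two_mul_prod_one_add_mul {ι : Type*} (s : Finset ι) (v : ι → R) {t : R} (ht : t ^ 3 = 0) :
    2 * ∏ i ∈ s, (1 + t * v i) =
      2 + 2 * t * ∑ i ∈ s, v i + t ^ 2 * ((∑ i ∈ s, v i) ^ 2 - ∑ i ∈ s, v i ^ 2) := by
  classical
  induction s using Finset.induction_on with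
  | empty => simp
  | insert a s ha ih =>
    rw [Finset.prod_insert ha, Finset.sum_insert ha, Finset.sum_insert ha]
    linear_combination (1 + t * v a) * ih +
      v a * ((∑ i ∈ s, v i) ^ 2 - ∑ i ∈ s, v i ^ 2) * ht

variable {g : R → R}

theorem apply_add_natCast (hg : ∀ x, g (x + 1) = unitPart x ^ 2 * g x) (x : R) (n : ℕ) :
    g (x + n) = (∏ j ∈ Finset.range n, unitPart (x + j)) ^ 2 * g x := by
  induction n with
  | zero => simp
  | succ n ih =>
    rw [Nat.cast_succ, ← add_assoc, hg, ih, Finset.prod_range_succ]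
    ring

theorem prod_unitPart_add_nilpotent_mul {ε : R} (hε : ε ^ 3 = 0) (h2 : IsUnit (2 : R)) (n : ℕ)
    (a y : R) (h1 : ε ^ 2 * ∑ j ∈ Finset.range n, Ring.inverse (a + j) = 0)
    (hs : ε ^ 2 * ∑ j ∈ Finset.range n, Ring.inverse (a + j) ^ 2 = 0) :
    ∏ j ∈ Finset.range n, unitPart (a + ε * y + j) =
      (∏ j ∈ Finset.range n, unitPart (a + j)) *
        (1 + ε * y * ∑ j ∈ Finset.range n, Ring.inverse (a + j)) := by
  have e : ∀ j ∈ Finset.range n, unitPart (a + ε * y + j) =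
      unitPart (a + j) * (1 + ε * y * Ring.inverse (a + j)) := by
    intro j _
    rw [← unitPart_add_nilpotent_mul hε]
    congr 1
    ring
  rw [Finset.prod_congr rfl e, Finset.prod_mul_distrib]
  congr 1
  refine h2.mul_left_cancel ?_
  rw [two_mul_prod_one_add_mul _ _ (show (ε * y) ^ 3 = 0 by rw [mul_pow, hε, zero_mul])]
  linear_combination y ^ 2 * (∑ j ∈ Finset.range n, Ring.inverse (a + j)) * h1 - y ^ 2 * hs

/-- The symmetric second-order expansion of `log g` at `a` in steps of `n`. Going from `x` to
`x + 1` multiplies the left side by a quotient of two products over windows of length `n`, which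
is `1 + 2 (2 x + 1) n S` with `S` the sum of the inverses. -/
theorem apply_add_mul_apply_sub (hg : ∀ x, g (x + 1) = unitPart x ^ 2 * g x) {n : ℕ}
    (hn : (n : R) ^ 3 = 0) (h2 : IsUnit (2 : R)) (a : R)
    (h1 : (n : R) ^ 2 * ∑ j ∈ Finset.range n, Ring.inverse (a + j) = 0)
    (hs : (n : R) ^ 2 * ∑ j ∈ Finset.range n, Ring.inverse (a + j) ^ 2 = 0) (x : ℕ) :
    g (a + n * x) * g (a - n * x) =
      g a ^ 2 * (1 + 2 * n * x ^ 2 * ∑ j ∈ Finset.range n, Ring.inverse (a + j)) := by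
  induction x with
  | zero => simp; ring
  | succ x ih =>
    have w1 := apply_add_natCast hg (a + n * x) n
    have w2 := apply_add_natCast hg (a + n * (-(x + 1))) n
    rw [prod_unitPart_add_nilpotent_mul hn h2 n a _ h1 hs] at w1 w2
    have hW : IsUnit (∏ j ∈ Finset.range n, unitPart (a + (j : R))) :=
      (Finset.prod_induction _ IsUnit (fun _ _ => IsUnit.mul) isUnit_one
        fun j _ => isUnit_unitPart _)
    rw [show a + n * (-((x : R) + 1)) + n = a - n * x by ring] at w2
    rw [show a + n * (x : R) + n = a + n * ((x + 1 : ℕ) : R) by push_cast; ring] at w1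
    rw [show a + n * (-((x : R) + 1)) = a - n * ((x + 1 : ℕ) : R) by push_cast; ring] at w2
    set W := ∏ j ∈ Finset.range n, unitPart (a + (j : R))
    set S := ∑ j ∈ Finset.range n, Ring.inverse (a + (j : R))
    have hS : (n * S) ^ 2 = 0 := by linear_combination S * h1
    have key : g (a + n * ((x + 1 : ℕ) : R)) * g (a - n * ((x + 1 : ℕ) : R)) *
        (1 + n * -(x + 1) * S) ^ 2 = (1 + n * x * S) ^ 2 * (g (a + n * x) * g (a - n * x)) := by
      refine (hW.pow 2).mul_left_cancel ?_
      linear_combination (-g (a + n * ((x + 1 : ℕ) : R))) * w2 + g (a - n * x) * w1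
    rw [ih] at key
    generalize g (a + n * ((x + 1 : ℕ) : R)) * g (a - n * ((x + 1 : ℕ) : R)) = G at *
    have hz : ∀ z : R, (1 + n * -z * S) ^ 2 * (1 + 2 * n * z * S) = 1 := by
      intro z
      linear_combination (2 * z ^ 3 * n * S - 3 * z ^ 2) * hS
    have h3 : G = (1 + n * x * S) ^ 2 *
        (g a ^ 2 * (1 + 2 * n * x ^ 2 * S)) * (1 + 2 * n * (x + 1) * S) := by
      linear_combination (-G) * hz (x + 1) + (1 + 2 * n * (x + 1) * S) * key
    have h4 : ∀ z : R, (1 + n * z * S) ^ 2 * (1 + 2 * n * z ^ 2 * S) * (1 + 2 * n * (z + 1) * S) =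
        1 + 2 * n * (z + 1) ^ 2 * S := by
      intro z
      have hS3 : (n * S) ^ 3 = 0 := by rw [pow_succ, hS, zero_mul]
      have hS4 : (n * S) ^ 4 = 0 := by rw [pow_succ, hS3, zero_mul]
      ring_nf at hS hS3 hS4 ⊢
      simp only [hS, hS3, hS4, mul_assoc, zero_mul]
      grind
    rw [h3, Nat.cast_succ]
    linear_combination g a ^ 2 * h4 x

/-- Second-order expansion of the harmonic-type sum at `1 / 3`, for `n = 3 N + 1`: in the blocks
`j ≤ 2 N` and `2 N < j ≤ 3 N` the reflection of the index pairs `3 j + 1` with a number congruent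
to its negative modulo `n`. -/
theorem two_mul_sum_inverse_three_mul_add_one (N : ℕ) {n : ℕ} (hn : n = 3 * N + 1)
    (h0 : (n : R) ^ 3 = 0)
    (hs : (n : R) ^ 2 * ∑ j ∈ Finset.range n, Ring.inverse (3 * j + 1 : R) ^ 2 = 0) :
    2 * (n * ∑ j ∈ Finset.range n, Ring.inverse (3 * j + 1 : R)) =
      -(3 * (n ^ 2 * ∑ i ∈ Finset.range N, Ring.inverse (3 * i + 2 : R) ^ 2)) := by
  have hc : (n : R) = 3 * N + 1 := by rw [hn]; push_cast; ring
  have refl : ∀ (M : ℕ) (d c : R), (∀ j ∈ Finset.range M,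
      (3 * (d + j) + 1) + (3 * (d + ((M - 1 - j : ℕ) : R)) + 1) = n * c) →
      2 * (n * ∑ j ∈ Finset.range M, Ring.inverse (3 * (d + j) + 1 : R)) =
        -(c * (n ^ 2 * ∑ j ∈ Finset.range M, Ring.inverse (3 * (d + j) + 1 : R) ^ 2)) := by
    intro M d c h
    have e := Finset.sum_range_reflect (fun j : ℕ => Ring.inverse (3 * (d + j) + 1 : R)) M
    rw [two_mul]
    nth_rewrite 2 [← e]
    rw [← mul_add, ← Finset.sum_add_distrib, Finset.mul_sum, Finset.mul_sum, Finset.mul_sum,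
      ← Finset.sum_neg_distrib]
    refine Finset.sum_congr rfl fun j hj => ?_
    rw [mul_inverse_add_inverse h0 (h j hj)]
    ring
  have r1 := refl (2 * N + 1) 0 2 (fun j hj => by
    have : j ≤ 2 * N := by simpa [Nat.lt_succ_iff] using hj
    rw [hc, show 2 * N + 1 - 1 - j = 2 * N - j by omega, Nat.cast_sub this]; push_cast; ring)
  have r2 := refl N (2 * N + 1) 5 (fun j hj => by
    have : j < N := by simpa using hj
    rw [hc, show N - 1 - j = N - (1 + j) by omega, Nat.cast_sub (by omega)]; push_cast; ring)
  have e2 : (n : R) ^ 2 * ∑ j ∈ Finset.range N, Ring.inverse (3 * (2 * N + 1 + j) + 1 : R) ^ 2 =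
      n ^ 2 * ∑ i ∈ Finset.range N, Ring.inverse (3 * i + 2 : R) ^ 2 := by
    rw [Finset.mul_sum, Finset.mul_sum]
    refine Finset.sum_congr rfl fun j _ => ?_
    have := sq_mul_inverse_add_nilpotent_mul h0 (3 * j + 2 : R) 2
    rw [show 3 * (2 * N + 1 + j) + 1 = (3 * j + 2 : R) + n * 2 by rw [hc]; ring]
    linear_combination (Ring.inverse ((3 * j + 2 : R) + n * 2) + Ring.inverse (3 * j + 2 : R)) *
      this
  have split : ∀ f : ℕ → R, ∑ j ∈ Finset.range n, f j =
      ∑ j ∈ Finset.range (2 * N + 1), f j + ∑ j ∈ Finset.range N, f (2 * N + 1 + j) := by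
    intro f
    rw [← Finset.sum_range_add, hn]
    congr 2; omega
  rw [split] at hs ⊢
  push_cast at hs r1 r2 ⊢
  simp only [zero_add] at r1
  linear_combination r1 + r2 - 2 * hs - 3 * e2

theorem apply_mul_apply_one_sub (hg : ∀ x, g (x + 1) = unitPart x ^ 2 * g x) (h0 : g 0 = 1)
    (n : ℕ) : g n * g (1 - n) = 1 := by
  induction n with
  | zero =>
    have h := hg 0
    rw [h0, zero_add] at h
    rw [Nat.cast_zero, sub_zero, h0, h]
    by_cases hu : IsUnit (0 : R)
    · rw [unitPart_of_isUnit hu, isUnit_zero_iff.1 hu]; ring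
    · rw [unitPart_of_not_isUnit hu]; ring
  | succ n ih =>
    have h := hg (-n)
    rw [unitPart_neg_sq, neg_add_eq_sub] at h
    rw [Nat.cast_succ, hg, sub_add_cancel_right, mul_right_comm, ← ih, h]
    ring

/-- The two shifted factorials in terms of `g`, for `g` satisfying the functional equation and the
reflection formula. -/
theorem sq_prod_unitPart_two_mul_add (hg : ∀ x, g (x + 1) = unitPart x ^ 2 * g x)
    (hr : ∀ x, g x * g (1 - x) = 1) (h0 : g 0 = 1) {a : R} (ha : 3 * a = 1) (N : ℕ) :
    (∏ j ∈ Finset.range N, unitPart (2 * a + j)) ^ 2 =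
      (∏ j ∈ Finset.range N, unitPart (1 + j : R)) ^ 2 * (g (-N) * g (2 * a + N) * g a) := by
  have h1 := apply_add_natCast hg (2 * a) N
  have h2 := apply_add_natCast hg 1 N
  have h3 := hr a
  have h4 := hr (-N)
  have h5 := hr 0
  rw [h0, one_mul, sub_zero] at h5
  rw [show 1 - a = 2 * a by linear_combination -ha] at h3
  rw [sub_neg_eq_add] at h4
  rw [h5, mul_one] at h2
  rw [← h2, h1]
  linear_combination (-(∏ j ∈ Finset.range N, unitPart (2 * a + j)) ^ 2) *
    (g a * g (2 * a) * h4 + h3)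

end CommRing

/-! ### The square of the Gamma function modulo prime powers -/

/-- The square of Morita's Gamma function modulo `p ^ k`, as a function on `ℤ / p ^ k`. The value
at a residue class is taken at its least non-negative representative; the square makes the
functional equation and the reflection formula free of signs. -/
noncomputable def gammaSq (p : ℕ) [Fact p.Prime] (k : ℕ) (x : ZMod (p ^ k)) : ZMod (p ^ k) :=
  PadicInt.toZModPow k (moritaNat p x.val) ^ 2

section Gamma

variable (p : ℕ) [Fact p.Prime] {k : ℕ}

theorem toZModPow_moritaNat_congr (hp : p ≠ 2) {a b : ℕ} (hab : a ≡ b [MOD p ^ k]) :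
    PadicInt.toZModPow k (moritaNat p a) = PadicInt.toZModPow k (moritaNat p b) := by
  have hper : ∀ n c : ℕ, PadicInt.toZModPow k (moritaNat p (n + p ^ k * c))
      = PadicInt.toZModPow k (moritaNat p n) := by
    intro n c
    induction c with
    | zero => simp
    | succ c ih => rw [mul_add, mul_one, ← add_assoc, moritaNat_add_pow p hp, ih]
  rw [← Nat.mod_add_div a (p ^ k), ← Nat.mod_add_div b (p ^ k), hper, hper, hab]

theorem gammaSq_natCast (hp : p ≠ 2) (n : ℕ) :
    gammaSq p k n = PadicInt.toZModPow k (moritaNat p n) ^ 2 := by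
  rw [gammaSq, ZMod.val_natCast, toZModPow_moritaNat_congr p hp (Nat.mod_modEq n (p ^ k))]

theorem gammaSq_zero (hp : p ≠ 2) : gammaSq p k 0 = 1 := by
  have := gammaSq_natCast p (k := k) hp 0
  simpa [moritaNat] using this

theorem isUnit_natCast_zmod_pow (hk : k ≠ 0) (n : ℕ) :
    IsUnit (n : ZMod (p ^ k)) ↔ ¬ p ∣ n := by
  have hpp : p.Prime := Fact.out
  rw [ZMod.isUnit_iff_coprime, Nat.coprime_pow_right_iff (Nat.pos_of_ne_zero hk),
    Nat.coprime_comm, hpp.coprime_iff_not_dvd]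

theorem exists_natCast_eq_zmod_pow (x : ZMod (p ^ k)) : ∃ n : ℕ, (n : ZMod (p ^ k)) = x :=
  have hpp : p.Prime := Fact.out
  have : NeZero (p ^ k) := ⟨pow_ne_zero _ hpp.ne_zero⟩
  ZMod.natCast_zmod_surjective x

theorem gammaSq_add_one (hp : p ≠ 2) (hk : k ≠ 0) (x : ZMod (p ^ k)) :
    gammaSq p k (x + 1) = unitPart x ^ 2 * gammaSq p k x := by
  obtain ⟨n, rfl⟩ := exists_natCast_eq_zmod_pow p x
  rw [← Nat.cast_succ, gammaSq_natCast p hp, gammaSq_natCast p hp, moritaNat_eq, moritaNat_eq,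
    Finset.prod_range_succ, pow_succ (-1 : ℤ_[p])]
  have : PadicInt.toZModPow (p := p) k (if p ∣ n then 1 else (n : ℤ_[p])) =
      unitPart (n : ZMod (p ^ k)) := by
    by_cases hn : p ∣ n
    · rw [if_pos hn, map_one, unitPart_of_not_isUnit]
      rwa [isUnit_natCast_zmod_pow p hk, not_not]
    · rw [if_neg hn, map_natCast, unitPart_of_isUnit]
      rwa [isUnit_natCast_zmod_pow p hk]
  rw [map_mul, map_mul, map_mul, map_mul, this, map_neg, map_one]
  ring

theorem gammaSq_mul_gammaSq_one_sub (hp : p ≠ 2) (hk : k ≠ 0) (x : ZMod (p ^ k)) :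
    gammaSq p k x * gammaSq p k (1 - x) = 1 := by
  obtain ⟨n, rfl⟩ := exists_natCast_eq_zmod_pow p x
  exact apply_mul_apply_one_sub (gammaSq_add_one p hp hk) (gammaSq_zero p hp) n

theorem toZModPow_eq_iff_norm_sub_le (x y : ℤ_[p]) :
    PadicInt.toZModPow k x = PadicInt.toZModPow k y ↔ ‖x - y‖ ≤ (p : ℝ) ^ (-(k : ℤ)) := by
  rw [PadicInt.norm_le_pow_iff_mem_span_pow, ← PadicInt.ker_toZModPow, RingHom.mem_ker,
    map_sub, sub_eq_zero]

theorem toZModPow_padicGamma_sq (hp : p ≠ 2) (x : ℤ_[p]) :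
    PadicInt.toZModPow k (padicGamma p x) ^ 2 = gammaSq p k (PadicInt.toZModPow k x) := by
  have hpp : p.Prime := Fact.out
  have : (Filter.comap (Nat.cast : ℕ → ℤ_[p]) (nhds x)).NeBot := by
    rw [Filter.comap_neBot_iff_frequently]
    exact (mem_closure_iff_frequently.1 (PadicInt.denseRange_natCast (p := p) x)).mono
      fun y hy => hy
  have hpos : (0 : ℝ) < (p : ℝ) ^ (-(k : ℤ)) := zpow_pos (by exact_mod_cast hpp.pos) _
  have hball : ∀ y : ℤ_[p], ∀ᶠ z in nhds y,
      PadicInt.toZModPow k z = PadicInt.toZModPow k y := by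
    intro y
    filter_upwards [Metric.ball_mem_nhds y hpos] with z hz
    rw [Metric.mem_ball, dist_eq_norm] at hz
    exact (toZModPow_eq_iff_norm_sub_le p z y).2 hz.le
  obtain ⟨n, h1, h2⟩ := (((tendsto_moritaNat p hp x).eventually (hball _)).and
    (Filter.tendsto_comap.eventually (hball x))).exists
  rw [← h1, ← h2, map_natCast, gammaSq_natCast p hp]

end Gamma

/-! ### Power sums over residues -/

section Residues

variable (p : ℕ) [Fact p.Prime]

theorem sum_range_add_zmod {M : Type*} [AddCommMonoid M] (f : ZMod p → M) (a : ZMod p) :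
    ∑ j ∈ Finset.range p, f (a + j) = ∑ b, f b := by
  have e1 : ∑ j ∈ Finset.range p, f (a + j) = ∑ b : ZMod p, f (a + b) := by
    refine Finset.sum_bij' (fun i _ => (i : ZMod p)) (fun b _ => b.val) ?_ ?_ ?_ ?_ ?_
    · intro i _; exact Finset.mem_univ _
    · intro b _; exact Finset.mem_range.2 (ZMod.val_lt b)
    · intro i hi; exact ZMod.val_cast_of_lt (Finset.mem_range.1 hi)
    · intro b _; exact ZMod.natCast_zmod_val b
    · intro i _; rfl
  rw [e1]
  exact Equiv.sum_comp (Equiv.addLeft a) f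

/-- A power sum of low exponent over the inverses of a full set of residues modulo `p` vanishes
modulo `p`, and multiplying by `p ^ 2` makes this an identity modulo `p ^ 3`. -/
theorem sq_mul_sum_inverse_pow {e : ℕ} (he : e < p - 1) (a : ZMod (p ^ 3)) :
    (p : ZMod (p ^ 3)) ^ 2 * ∑ j ∈ Finset.range p, Ring.inverse (a + (j : ZMod (p ^ 3))) ^ e = 0 := by
  have hpp : p.Prime := Fact.out
  set ρ := ZMod.castHom (dvd_pow_self p three_ne_zero) (ZMod p) with hρ
  have hker : ∀ x : ZMod (p ^ 3), ρ x = 0 → (p : ZMod (p ^ 3)) ^ 2 * x = 0 := by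
    intro x hx
    obtain ⟨n, rfl⟩ := exists_natCast_eq_zmod_pow p x
    rw [map_natCast, ZMod.natCast_eq_zero_iff] at hx
    rw [← Nat.cast_pow, ← Nat.cast_mul, ZMod.natCast_eq_zero_iff, pow_succ]
    exact mul_dvd_mul_left _ hx
  have hinv : ∀ x : ZMod (p ^ 3), ρ (Ring.inverse x) = (ρ x)⁻¹ := by
    intro x
    by_cases hx : IsUnit x
    · rw [map_ringInverse_of_isUnit ρ hx, Ring.inverse_eq_inv]
    · rw [Ring.inverse_non_unit x hx, map_zero]
      obtain ⟨n, rfl⟩ := exists_natCast_eq_zmod_pow p x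
      rw [isUnit_natCast_zmod_pow p three_ne_zero, not_not] at hx
      rw [map_natCast, (ZMod.natCast_eq_zero_iff _ _).2 hx, inv_zero]
  refine hker _ ?_
  simp only [map_sum, map_pow, hinv, map_add, map_natCast]
  rw [sum_range_add_zmod p (fun b => b⁻¹ ^ e)]
  have := Equiv.sum_comp (Equiv.inv (ZMod p)) (fun b => b ^ e)
  simp only [Equiv.inv_apply] at this
  rw [this]
  exact FiniteField.sum_pow_lt_card_sub_one (ZMod p) e (by rwa [ZMod.card])

end Residues

/-! ### Shifted factorials modulo prime powers -/

section Congruences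

theorem natCast_zmod_pow_self (p k : ℕ) : (p : ZMod (p ^ k)) ^ k = 0 := by
  rw [← Nat.cast_pow, ZMod.natCast_self]

variable (p : ℕ) [Fact p.Prime]

theorem prod_unitPart_one_add {k : ℕ} (hk : k ≠ 0) {N : ℕ} (hN : N < p) :
    ∏ j ∈ Finset.range N, unitPart (1 + j : ZMod (p ^ k)) = (N.factorial : ZMod (p ^ k)) := by
  rw [← Finset.prod_range_add_one_eq_factorial, Nat.cast_prod]
  refine Finset.prod_congr rfl fun j hj => ?_
  rw [Finset.mem_range] at hj
  have : IsUnit ((j + 1 : ℕ) : ZMod (p ^ k)) :=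
    (isUnit_natCast_zmod_pow p hk _).2 fun h => by
      have := Nat.le_of_dvd (by omega) h
      omega
  rw [← unitPart_of_isUnit this]
  congr 1
  push_cast; ring

theorem isUnit_two_mul_add_iff {k : ℕ} (hk : k ≠ 0) {a : ZMod (p ^ k)} (ha : 3 * a = 1) (j : ℕ) :
    IsUnit (2 * a + j) ↔ ¬ p ∣ 3 * j + 2 := by
  have h3 : IsUnit (3 : ZMod (p ^ k)) := IsUnit.of_mul_eq_one _ ha
  rw [← isUnit_natCast_zmod_pow p hk, ← h3.mul_left_iff (b := 2 * a + j)]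
  have : 3 * (2 * a + j) = ((3 * j + 2 : ℕ) : ZMod (p ^ k)) := by
    push_cast; linear_combination 2 * ha
  rw [this]

/-- The congruence modulo `p ^ 3` for `p ≡ 1 (mod 3)`, inside `ℤ / p ^ 3`. Here `-N = a - p a` and
`2 a + N = a + p a`. -/
theorem sq_prod_mul_eq_gammaSq_pow (hp : p ≠ 2) {N : ℕ} (hN : p = 3 * N + 1)
    {a : ZMod (p ^ 3)} (ha : 3 * a = 1) :
    (∏ j ∈ Finset.range N, (2 * a + (j : ZMod (p ^ 3)))) ^ 2 *
        (1 + p ^ 2 * ∑ i ∈ Finset.range N, Ring.inverse (3 * i + 2 : ZMod (p ^ 3)) ^ 2) =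
      (N.factorial : ZMod (p ^ 3)) ^ 2 * gammaSq p 3 a ^ 3 := by
  have hpp : p.Prime := Fact.out
  have hN0 : N ≠ 0 := by rintro rfl; exact hpp.one_lt.ne' hN
  have hN1 : N ≠ 1 := by rintro rfl; rw [hN] at hpp; revert hpp; norm_num
  have h3 : IsUnit (3 : ZMod (p ^ 3)) := IsUnit.of_mul_eq_one _ ha
  have h2 : IsUnit (2 : ZMod (p ^ 3)) := by
    have := (isUnit_natCast_zmod_pow p three_ne_zero 2).2 fun h => by
      have := Nat.le_of_dvd two_pos h
      omega
    exact_mod_cast this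
  have hg := gammaSq_add_one p (k := 3) hp three_ne_zero
  have hr := gammaSq_mul_gammaSq_one_sub p (k := 3) hp three_ne_zero
  have hπ := natCast_zmod_pow_self p 3
  have hc : (p : ZMod (p ^ 3)) = 3 * N + 1 := by
    rw [show (3 * N + 1 : ZMod (p ^ 3)) = ((3 * N + 1 : ℕ) : ZMod (p ^ 3)) by push_cast; rfl, ← hN]
  have key := sq_prod_unitPart_two_mul_add hg hr (gammaSq_zero p hp) ha N
  rw [prod_unitPart_one_add p three_ne_zero (by omega)] at key
  have hprod : ∏ j ∈ Finset.range N, unitPart (2 * a + j) =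
      ∏ j ∈ Finset.range N, (2 * a + (j : ZMod (p ^ 3))) := by
    refine Finset.prod_congr rfl fun j hj => ?_
    rw [Finset.mem_range] at hj
    refine unitPart_of_isUnit ((isUnit_two_mul_add_iff p three_ne_zero ha j).2 fun h => ?_)
    have := Nat.le_of_dvd (by omega) h
    omega
  rw [hprod] at key
  have s1 : ∀ b : ZMod (p ^ 3),
      (p : ZMod (p ^ 3)) ^ 2 * ∑ j ∈ Finset.range p, Ring.inverse (b + (j : ZMod (p ^ 3))) = 0 := by
    intro b
    have := sq_mul_sum_inverse_pow p (e := 1) (by omega) b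
    simpa only [pow_one] using this
  have s2 := sq_mul_sum_inverse_pow p (e := 2) (by omega) a
  have hinv : ∀ j : ℕ, Ring.inverse (a + (j : ZMod (p ^ 3))) =
      3 * Ring.inverse (3 * j + 1 : ZMod (p ^ 3)) := by
    intro j
    rw [show (3 * j + 1 : ZMod (p ^ 3)) = 3 * (a + j) by linear_combination -ha,
      Ring.mul_inverse_rev, mul_left_comm, Ring.mul_inverse_cancel _ h3, mul_one]
  obtain ⟨x, hx⟩ := exists_natCast_eq_zmod_pow p a
  have hsym := apply_add_mul_apply_sub hg hπ h2 a (s1 a) s2 x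
  rw [hx] at hsym
  have hharm := two_mul_sum_inverse_three_mul_add_one N hN hπ (by
    simp only [hinv, mul_pow, ← Finset.mul_sum] at s2
    refine (h3.pow 2).mul_left_cancel ?_
    linear_combination s2)
  rw [show -(N : ZMod (p ^ 3)) = a - p * a by rw [hc]; linear_combination (N : ZMod (p ^ 3)) * ha,
    show 2 * a + (N : ZMod (p ^ 3)) = a + p * a by
      rw [hc]; linear_combination (-N : ZMod (p ^ 3)) * ha] at key
  have hS : ∑ j ∈ Finset.range p, Ring.inverse (a + (j : ZMod (p ^ 3))) =
      3 * ∑ j ∈ Finset.range p, Ring.inverse (3 * j + 1 : ZMod (p ^ 3)) := by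
    rw [Finset.mul_sum]; exact Finset.sum_congr rfl fun j _ => hinv j
  rw [hS] at hsym
  set S₁ := ∑ j ∈ Finset.range p, Ring.inverse (3 * j + 1 : ZMod (p ^ 3))
  set S₂ := ∑ i ∈ Finset.range N, Ring.inverse (3 * i + 2 : ZMod (p ^ 3)) ^ 2
  have hfac : 1 + 2 * p * a ^ 2 * (3 * S₁) = 1 - p ^ 2 * S₂ := by
    linear_combination 3 * a ^ 2 * hharm - (3 * a + 1) * p ^ 2 * S₂ * ha
  rw [hfac] at hsym
  rw [key, mul_comm (gammaSq p 3 (a - p * a)), hsym]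
  linear_combination (-(N.factorial : ZMod (p ^ 3)) ^ 2 * gammaSq p 3 a ^ 3 * S₂ ^ 2 * p) * hπ

/-- The congruence modulo `p` for `p ≡ 2 (mod 3)`, inside `ℤ / p`, after removal of the one factor
divisible by `p`. -/
theorem sq_prod_erase_eq_gammaSq_pow (hp : p ≠ 2) {m : ℕ} (hm : p = 3 * m + 2)
    {a : ZMod (p ^ 1)} (ha : 3 * a = 1) :
    (∏ j ∈ (Finset.range (2 * m + 1)).erase m, (2 * a + (j : ZMod (p ^ 1)))) ^ 2 =
      ((2 * m + 1).factorial : ZMod (p ^ 1)) ^ 2 * gammaSq p 1 a ^ 3 := by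
  have hc : (3 * m + 2 : ZMod (p ^ 1)) = 0 := by
    have h := natCast_zmod_pow_self p 1
    rw [show (3 * m + 2 : ZMod (p ^ 1)) = ((3 * m + 2 : ℕ) : ZMod (p ^ 1)) by push_cast; rfl,
      ← hm]
    exact (pow_one _).symm.trans h
  have key := sq_prod_unitPart_two_mul_add (gammaSq_add_one p (k := 1) hp one_ne_zero)
    (gammaSq_mul_gammaSq_one_sub p hp one_ne_zero) (gammaSq_zero p hp) ha (2 * m + 1)
  rw [prod_unitPart_one_add p one_ne_zero (by omega)] at key
  have hprod : ∏ j ∈ Finset.range (2 * m + 1), unitPart (2 * a + j) =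
      ∏ j ∈ (Finset.range (2 * m + 1)).erase m, (2 * a + (j : ZMod (p ^ 1))) := by
    rw [← Finset.mul_prod_erase _ _ (show m ∈ Finset.range (2 * m + 1) by
      rw [Finset.mem_range]; omega), unitPart_of_not_isUnit (x := 2 * a + m), one_mul]
    · refine Finset.prod_congr rfl fun j hj => ?_
      rw [Finset.mem_erase, Finset.mem_range] at hj
      refine unitPart_of_isUnit ((isUnit_two_mul_add_iff p one_ne_zero ha j).2 fun h => ?_)
      obtain ⟨c, hc⟩ := h
      have : c < 2 := by
        by_contra hge
        have := Nat.mul_le_mul_left p (not_lt.1 hge)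
        omega
      interval_cases c <;> omega
    · rw [isUnit_two_mul_add_iff p one_ne_zero ha, not_not, hm]
  rw [hprod] at key
  rw [key, show -((2 * m + 1 : ℕ) : ZMod (p ^ 1)) = a by
      push_cast; linear_combination (2 * m + 1 : ZMod (p ^ 1)) * ha - 2 * a * hc,
    show 2 * a + ((2 * m + 1 : ℕ) : ZMod (p ^ 1)) = a by
      push_cast; linear_combination (-(2 * m + 1) : ZMod (p ^ 1)) * ha + 2 * a * hc]
  ring

end Congruences

/-! ### Congruences between `p`-adic numbers -/

section PadicNumbers

variable (p : ℕ) [Fact p.Prime]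

theorem padicCongr_of_toZModPow_eq {k : ℕ} {x y : ℤ_[p]}
    (h : PadicInt.toZModPow k x = PadicInt.toZModPow k y) : PadicCongr p (p ^ k) x y := by
  rw [← sub_eq_zero, ← map_sub, ← RingHom.mem_ker, PadicInt.ker_toZModPow,
    Ideal.mem_span_singleton] at h
  obtain ⟨z, hz⟩ := h
  refine ⟨z, ?_⟩
  rw [← PadicInt.coe_sub, hz]
  push_cast
  rfl

variable {p}

theorem PadicCongr.symm {m : ℕ} {x y : ℚ_[p]} (h : PadicCongr p m x y) : PadicCongr p m y x := by
  obtain ⟨z, hz⟩ := h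
  exact ⟨-z, by rw [PadicInt.coe_neg]; linear_combination -hz⟩

theorem PadicCongr.trans {m : ℕ} {x y z : ℚ_[p]} (h : PadicCongr p m x y)
    (h' : PadicCongr p m y z) : PadicCongr p m x z := by
  obtain ⟨a, ha⟩ := h
  obtain ⟨b, hb⟩ := h'
  exact ⟨a + b, by rw [PadicInt.coe_add]; linear_combination ha + hb⟩

theorem PadicCongr.congr_iff {m : ℕ} {x x' y y' : ℚ_[p]} (hx : PadicCongr p m x x')
    (hy : PadicCongr p m y y') : PadicCongr p m x y ↔ PadicCongr p m x' y' :=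
  ⟨fun h => (hx.symm.trans h).trans hy, fun h => (hx.trans h).trans hy.symm⟩

variable (p)

theorem coe_ringInverse {x : ℤ_[p]} (hx : IsUnit x) :
    ((Ring.inverse x : ℤ_[p]) : ℚ_[p]) = (x : ℚ_[p])⁻¹ := by
  refine eq_inv_of_mul_eq_one_left ?_
  rw [← PadicInt.coe_mul, Ring.inverse_mul_cancel _ hx, PadicInt.coe_one]

theorem coe_prod_padicInt {ι : Type*} (s : Finset ι) (f : ι → ℤ_[p]) :
    ((∏ i ∈ s, f i : ℤ_[p]) : ℚ_[p]) = ∏ i ∈ s, (f i : ℚ_[p]) :=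
  map_prod (PadicInt.Coe.ringHom (p := p)) f s

theorem isUnit_natCast_padicInt (n : ℕ) : IsUnit (n : ℤ_[p]) ↔ ¬ p ∣ n := by
  have hpp : p.Prime := Fact.out
  rw [PadicInt.isUnit_iff, PadicInt.norm_natCast_eq_one_iff, hpp.coprime_iff_not_dvd]

theorem isUnit_factorial {n : ℕ} (hn : n < p) : IsUnit (n.factorial : ℤ_[p]) := by
  have hpp : p.Prime := Fact.out
  rwa [isUnit_natCast_padicInt, hpp.dvd_factorial, not_le]

theorem coe_oneThird (hp : p ≠ 3) : (oneThird p : ℚ_[p]) = 1 / 3 := by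
  have := congrArg (fun x : ℤ_[p] => (x : ℚ_[p])) (three_mul_oneThird p hp)
  push_cast at this
  have h3 : ((3 : ℤ_[p]) : ℚ_[p]) = 3 := rfl
  rw [h3] at this
  exact eq_div_of_mul_eq three_ne_zero (by rw [mul_comm, this])

theorem three_mul_toZModPow_oneThird (hp : p ≠ 3) (k : ℕ) :
    3 * PadicInt.toZModPow k (oneThird p) = 1 := by
  rw [← map_ofNat (PadicInt.toZModPow k) 3, ← map_mul, three_mul_oneThird p hp, map_one]

theorem shiftedFactorial_eq_prod (x : ℚ_[p]) (n : ℕ) :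
    shiftedFactorial p x n = ∏ j ∈ Finset.range n, (x + j) := by
  induction n with
  | zero => simp [shiftedFactorial]
  | succ n ih =>
    rw [Finset.prod_range_succ, ← ih, shiftedFactorial, ascPochhammer_succ_eval, shiftedFactorial]

theorem closedForm_eq {t N : ℕ} (h : t * p = 3 * N + 1) :
    closedForm p t = (∏ j ∈ Finset.range N, (2 / 3 + j : ℚ_[p])) ^ 2 /
      (N.factorial : ℚ_[p]) ^ 2 * (1 + (-1) ^ (t - 1) * ((t : ℚ_[p]) * (p : ℚ_[p])) ^ 2 *
        ∑ i ∈ Finset.range N, 1 / (3 * i + 2 : ℚ_[p]) ^ 2) := by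
  have hN : (t * p - 1) / 3 = N := by omega
  have hsum : ∑ i ∈ Finset.Icc 1 N, 1 / (3 * (i : ℚ_[p]) - 1) ^ 2 =
      ∑ i ∈ Finset.range N, 1 / (3 * i + 2 : ℚ_[p]) ^ 2 := by
    rw [show Finset.Icc 1 N = Finset.Ico (0 + 1) (N + 1) by ext; simp,
      ← Finset.sum_Ico_add', Finset.range_eq_Ico]
    refine Finset.sum_congr rfl fun i _ => ?_
    push_cast
    congr 2
    ring
  rw [closedForm, hN, hsum, shiftedFactorial_eq_prod, shiftedFactorial, ascPochhammer_eval_one]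

/-- The terms with `N < k < p` contain the factor `1 / 3 + N = t p / 3` to the third power. -/
theorem truncatedSum_congr (hp : p ≠ 3) {t N : ℕ} (h : t * p = 3 * N + 1) (hN : N < p) :
    PadicCongr p (p ^ 3) (truncatedSum p N) (truncatedSum p (p - 1)) := by
  have hpp : p.Prime := Fact.out
  suffices H : ∀ d, N + d < p →
      PadicCongr p (p ^ 3) (truncatedSum p N) (truncatedSum p (N + d)) by
    have := H (p - 1 - N) (by omega)
    rwa [show N + (p - 1 - N) = p - 1 by omega] at this
  intro d
  induction d with
  | zero => exact fun _ => ⟨0, by simp⟩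
  | succ d ih =>
    intro hd
    refine (ih (by omega)).trans ⟨-((t * oneThird p *
      ∏ j ∈ (Finset.range (N + d + 1)).erase N, (oneThird p + j)) ^ 3 *
        Ring.inverse ((N + d + 1).factorial : ℤ_[p]) ^ 3), ?_⟩
    have hpos : (1 / 3 + N : ℚ_[p]) = p * (t * (1 / 3)) := by
      have : (t * p : ℚ_[p]) = 3 * N + 1 := by exact_mod_cast h
      linear_combination (-1 / 3) * this
    rw [truncatedSum, truncatedSum, ← add_assoc, Finset.sum_range_succ _ (N + d + 1),
      shiftedFactorial_eq_prod, ← Finset.mul_prod_erase _ _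
        (show N ∈ Finset.range (N + d + 1) by rw [Finset.mem_range]; omega), hpos]
    simp only [PadicInt.coe_mul, PadicInt.coe_add, PadicInt.coe_neg, PadicInt.coe_pow,
      coe_prod_padicInt, PadicInt.coe_natCast, coe_oneThird p hp,
      coe_ringInverse p (isUnit_factorial p (show N + d + 1 < p by omega))]
    push_cast
    ring

theorem closedForm_one_congr (hp : p ≠ 2) (hp1 : p % 3 = 1) :
    PadicCongr p (p ^ 3) (closedForm p 1) ((padicGamma p (oneThird p) : ℚ_[p]) ^ 6) := by
  have hp3 : p ≠ 3 := by omega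
  obtain ⟨N, hN⟩ : ∃ N, p = 3 * N + 1 := ⟨p / 3, by omega⟩
  have hu : ∀ i ∈ Finset.range N, IsUnit ((3 * i + 2 : ℕ) : ℤ_[p]) := fun i hi => by
    rw [Finset.mem_range] at hi
    refine (isUnit_natCast_padicInt p _).2 fun h => ?_
    have := Nat.le_of_dvd (by omega) h
    omega
  have hf := isUnit_factorial p (show N < p by omega)
  have hE : closedForm p 1 = (((∏ j ∈ Finset.range N, (2 * oneThird p + j)) ^ 2 *
      Ring.inverse (N.factorial : ℤ_[p]) ^ 2 * (1 + p ^ 2 *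
        ∑ i ∈ Finset.range N, Ring.inverse ((3 * i + 2 : ℕ) : ℤ_[p]) ^ 2) : ℤ_[p]) : ℚ_[p]) := by
    have hsum : ∑ i ∈ Finset.range N, ((Ring.inverse ((3 * i + 2 : ℕ) : ℤ_[p]) : ℤ_[p]) : ℚ_[p]) ^ 2
        = ∑ i ∈ Finset.range N, 1 / (3 * i + 2 : ℚ_[p]) ^ 2 := by
      refine Finset.sum_congr rfl fun i hi => ?_
      rw [coe_ringInverse p (hu i hi), PadicInt.coe_natCast]
      push_cast
      rw [inv_pow, one_div]
    have h2 : ((2 : ℤ_[p]) : ℚ_[p]) = 2 := rfl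
    rw [closedForm_eq p (show 1 * p = 3 * N + 1 by omega), ← hsum]
    simp only [PadicInt.coe_mul, PadicInt.coe_add, PadicInt.coe_pow, coe_prod_padicInt,
      PadicInt.coe_sum, PadicInt.coe_natCast, PadicInt.coe_one, coe_ringInverse p hf,
      coe_oneThird p hp3, h2]
    simp only [div_eq_mul_inv, inv_pow, Nat.cast_one, tsub_self, pow_zero, one_mul]
  rw [hE, ← PadicInt.coe_pow]
  refine padicCongr_of_toZModPow_eq p ?_
  have key := sq_prod_mul_eq_gammaSq_pow p hp hN (three_mul_toZModPow_oneThird p hp3 3)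
  rw [← toZModPow_padicGamma_sq p hp] at key
  have hfm := hf.map (PadicInt.toZModPow (p := p) 3)
  have hfi := Ring.mul_inverse_cancel _ hfm
  have hsum : ∑ i ∈ Finset.range N,
        PadicInt.toZModPow 3 (Ring.inverse ((3 * i + 2 : ℕ) : ℤ_[p])) ^ 2 =
      ∑ i ∈ Finset.range N, Ring.inverse (3 * i + 2 : ZMod (p ^ 3)) ^ 2 :=
    Finset.sum_congr rfl fun i hi => by
      rw [map_ringInverse_of_isUnit _ (hu i hi), map_natCast]; push_cast; rfl
  simp only [map_mul, map_add, map_pow, map_prod, map_sum, map_natCast, map_one, hsum, map_ofNat,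
    map_ringInverse_of_isUnit _ hf] at hfi ⊢
  linear_combination Ring.inverse (N.factorial : ZMod (p ^ 3)) ^ 2 * key +
    (PadicInt.toZModPow 3 (padicGamma p (oneThird p))) ^ 6 *
      (N.factorial * Ring.inverse (N.factorial : ZMod (p ^ 3)) + 1) * hfi

theorem closedForm_two_congr (hp : p ≠ 2) (hp2 : p % 3 = 2) :
    PadicCongr p (p ^ 3) (closedForm p 2)
      (-((p : ℚ_[p]) ^ 2 / 3) * (padicGamma p (oneThird p) : ℚ_[p]) ^ 6) := by
  have hpp : p.Prime := Fact.out
  have hp0 : (p : ℚ_[p]) ≠ 0 := by exact_mod_cast hpp.ne_zero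
  have hp3 : p ≠ 3 := by omega
  obtain ⟨m, hm⟩ : ∃ m, p = 3 * m + 2 := ⟨p / 3, by omega⟩
  have hmem : m ∈ Finset.range (2 * m + 1) := by rw [Finset.mem_range]; omega
  have hpm : (p : ℚ_[p]) = 3 * m + 2 := by exact_mod_cast congrArg (Nat.cast (R := ℚ_[p])) hm
  have hu : ∀ i ∈ (Finset.range (2 * m + 1)).erase m, IsUnit ((3 * i + 2 : ℕ) : ℤ_[p]) := by
    intro i hi
    rw [Finset.mem_erase, Finset.mem_range] at hi
    refine (isUnit_natCast_padicInt p _).2 fun h => ?_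
    obtain ⟨c, hc⟩ := h
    have : c < 2 := by
      by_contra hge
      have := Nat.mul_le_mul_left p (not_lt.1 hge)
      omega
    interval_cases c <;> omega
  have hf := isUnit_factorial p (show 2 * m + 1 < p by omega)
  set S : ℤ_[p] :=
    ∑ i ∈ (Finset.range (2 * m + 1)).erase m, Ring.inverse ((3 * i + 2 : ℕ) : ℤ_[p]) ^ 2 with hS
  set Q : ℤ_[p] := ∏ j ∈ (Finset.range (2 * m + 1)).erase m, (2 * oneThird p + j) with hQ
  have h2 : ((2 : ℤ_[p]) : ℚ_[p]) = 2 := rfl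
  have hSc : (S : ℚ_[p]) =
      ∑ i ∈ (Finset.range (2 * m + 1)).erase m, 1 / (3 * i + 2 : ℚ_[p]) ^ 2 := by
    rw [hS, PadicInt.coe_sum]
    refine Finset.sum_congr rfl fun i hi => ?_
    rw [PadicInt.coe_pow, coe_ringInverse p (hu i hi), PadicInt.coe_natCast]
    push_cast
    rw [inv_pow, one_div]
  have hQc : (Q : ℚ_[p]) = ∏ j ∈ (Finset.range (2 * m + 1)).erase m, (2 / 3 + j : ℚ_[p]) := by
    simp only [hQ, coe_prod_padicInt, PadicInt.coe_add, PadicInt.coe_mul, PadicInt.coe_natCast,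
      coe_oneThird p hp3, h2, mul_one_div]
  -- The factor `2 / 3 + m = p / 3` and the summand `1 / p ^ 2` are split off.
  have hE : closedForm p 2 = p ^ 2 * ((oneThird p ^ 2 * Q ^ 2 *
      Ring.inverse ((2 * m + 1).factorial : ℤ_[p]) ^ 2 * (-3 - 4 * p ^ 2 * S) : ℤ_[p]) : ℚ_[p]) := by
    have h3 : ((3 : ℤ_[p]) : ℚ_[p]) = 3 := rfl
    have h4 : ((4 : ℤ_[p]) : ℚ_[p]) = 4 := rfl
    rw [closedForm_eq p (show 2 * p = 3 * (2 * m + 1) + 1 by omega),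
      ← Finset.mul_prod_erase _ _ hmem, ← Finset.add_sum_erase _ _ hmem, ← hQc, ← hSc, ← hpm,
      show (2 / 3 + m : ℚ_[p]) = p / 3 by rw [hpm]; ring]
    simp only [PadicInt.coe_mul, PadicInt.coe_sub, PadicInt.coe_neg, PadicInt.coe_pow,
      PadicInt.coe_natCast, coe_ringInverse p hf, coe_oneThird p hp3, h3, h4]
    have hf0 : ((2 * m + 1).factorial : ℚ_[p]) ≠ 0 := by exact_mod_cast Nat.factorial_ne_zero _
    field_simp
    push_cast
    ring
  have key := sq_prod_erase_eq_gammaSq_pow p hp hm (three_mul_toZModPow_oneThird p hp3 1)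
  rw [← toZModPow_padicGamma_sq p hp] at key
  have hcong : PadicCongr p (p ^ 1)
      ((oneThird p ^ 2 * Q ^ 2 * Ring.inverse ((2 * m + 1).factorial : ℤ_[p]) ^ 2 *
        (-3 - 4 * p ^ 2 * S) : ℤ_[p]) : ℚ_[p])
      ((-(oneThird p) * padicGamma p (oneThird p) ^ 6 : ℤ_[p]) : ℚ_[p]) := by
    refine padicCongr_of_toZModPow_eq p ?_
    have hfi := Ring.mul_inverse_cancel _ (hf.map (PadicInt.toZModPow (p := p) 1))
    have h31 := three_mul_toZModPow_oneThird p hp3 1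
    have hπ : (p : ZMod (p ^ 1)) ^ 2 = 0 := by
      rw [pow_two, (pow_one _).symm.trans (natCast_zmod_pow_self p 1), zero_mul]
    have hQm : PadicInt.toZModPow 1 Q = ∏ j ∈ (Finset.range (2 * m + 1)).erase m,
        (2 * PadicInt.toZModPow 1 (oneThird p) + (j : ZMod (p ^ 1))) := by
      simp only [hQ, map_prod, map_add, map_mul, map_ofNat, map_natCast]
    rw [← hQm] at key
    simp only [map_mul, map_sub, map_neg, map_pow, map_natCast, map_ofNat,
      map_ringInverse_of_isUnit _ hf, hπ] at hfi ⊢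
    set a := PadicInt.toZModPow 1 (oneThird p)
    set v := Ring.inverse ((2 * m + 1).factorial : ZMod (p ^ 1))
    set G := PadicInt.toZModPow 1 (padicGamma p (oneThird p))
    linear_combination (-3 * a ^ 2 * v ^ 2) * key -
      3 * a ^ 2 * G ^ 6 * ((2 * m + 1).factorial * v + 1) * hfi - a * G ^ 6 * h31
  obtain ⟨z, hz⟩ := hcong
  refine ⟨z, ?_⟩
  rw [hE]
  rw [PadicInt.coe_mul (-(oneThird p)), PadicInt.coe_neg, PadicInt.coe_pow, coe_oneThird p hp3]
    at hz
  push_cast at hz ⊢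
  linear_combination (p : ℚ_[p]) ^ 2 * hz

end PadicNumbers

theorem proposition1p4 (p : ℕ) [Fact p.Prime] (hp : p ≠ 2) :
    (p % 3 = 1 →
      PadicCongr p (p ^ 3) (closedForm p 1) ((padicGamma p (oneThird p) : ℚ_[p]) ^ 6)) ∧
    (p % 3 = 2 →
      PadicCongr p (p ^ 3) (closedForm p 2)
        (-((p : ℚ_[p]) ^ 2 / 3) * (padicGamma p (oneThird p) : ℚ_[p]) ^ 6)) ∧
    -- hence the congruence for the shorter sum is equivalent to the one for the sum up to `p - 1`
    (p % 3 = 1 →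
      (PadicCongr p (p ^ 3) (truncatedSum p ((p - 1) / 3)) (closedForm p 1) ↔
        PadicCongr p (p ^ 3) (truncatedSum p (p - 1))
          ((padicGamma p (oneThird p) : ℚ_[p]) ^ 6))) ∧
    (p % 3 = 2 →
      (PadicCongr p (p ^ 3) (truncatedSum p ((2 * p - 1) / 3)) (closedForm p 2) ↔
        PadicCongr p (p ^ 3) (truncatedSum p (p - 1))
          (-((p : ℚ_[p]) ^ 2 / 3) * (padicGamma p (oneThird p) : ℚ_[p]) ^ 6))) := by
  refine ⟨closedForm_one_congr p hp, closedForm_two_congr p hp, fun h => ?_, fun h => ?_⟩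
  · exact (truncatedSum_congr p (t := 1) (by omega) (by omega) (by omega)).congr_iff
      (closedForm_one_congr p hp h)
  · exact (truncatedSum_congr p (t := 2) (by omega) (by omega) (by omega)).congr_iff
      (closedForm_two_congr p hp h)
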